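/- Let $H_1,\dots,H_n\subset\mathbb C^\ell$ be distinct affine hyperplanes, $H_j=\{f_j=0\}$ with $f_j$ a polynomial of degree one, and let $U=\mathbb C^\ell\setminus\bigcup_j H_j$. For $\lambda\in\mathbb C^n$ let $\Phi_\lambda=\prod_j f_j^{\lambda_j}$ (a multivalued function on $U$), $\omega_\lambda=d\log\Phi_\lambda=\sum_j\lambda_j\,d\log f_j$, and let $\operatorname{crit}(\Phi_\lambda)\subset U$ be the set of points where $d\Phi_\lambda=0$, i.e. the zero locus of $\omega_\lambda$ in $U$. Let $\Lambda=(\xi_1,\dots,\xi_q)$ with $\xi_i\in\mathbb Z^n$ be such that the one-forms $\omega_{\xi_1},\dots,\omega_{\xi_q}$ on $U$ are linearly independent over $\mathbb C$, and let $$\Phi_\Lambda=(\Phi_{\xi_1},\dots,\Phi_{\xi_q})\colon U\to(\mathbb C^*)^q\subset\mathbb C^q=\mathbb P^q\setminus\{z_0=0\}.$$ Let $Y=\Phi_\Lambda(U)$ and let $\bar Y$ be the Zariski closure of $Y$ in $\mathbb P^q$. Suppose that $\bar Y$ is a hypersurface $P=0$, that is, its homogeneous ideal is generated by one nonzero homogeneous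 polynomial $P\in\mathbb C[z_0,\dots,z_q]$. Suppose further that 1. $\Phi_\Lambda$ is nonsingular on $U$: its Jacobian has rank $q-1=\dim\bar Y$ at every point of $U$; 2. $\bar Y$ is nonsingular and meets the coordinate hyperplanes transversely: at every $y\in\bar Y$, the conormal vector $(\partial_0P(y),\dots,\partial_qP(y))$ of $\bar Y$ and the conormal vectors of all coordinate hyperplanes $z_i=0$ through $y$ are linearly independent; 3. $\dim\rho(\bar Y)=\dim\bar Y$, where $\rho=[z_0\partial_0P:\cdots:z_q\partial_qP]\colon\mathbb P^q\dashrightarrow\mathbb P^q$; 4. $\Phi_\Lambda(U)=\bar Y\cap(\mathbb C^*)^q$. Let $a_1,\dots,a_q\in\mathbb C$, put $a_0=-\sum_{i=1}^q a_i$, and assume $a_i\neq0$ for all $i=0,1,\dots,q$. If $\Phi=\Phi_\lambda$ is a master function with $d\log\Phi=\sum_{i=1}^q a_i\,\omega_{\xi_i}$ on $U$, then $\operatorname{crit}(\Phi)$ is nonempty and each of its irreducible components has codimension $q-1$. -/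

import Mathlib

open MvPolynomial Topology
open scoped LinearAlgebra.Projectivization

noncomputable section

namespace MasterFunction

/-! ### Affine arrangements, master functions, critical loci -/

/-- `f j = 0`, `j : Fin n`, is an arrangement of `n` distinct affine hyperplanes in `ℂ ^ ℓ`,
given by polynomials `f j` of degree one. -/
structure IsArrangement {ℓ n : ℕ} (f : Fin n → MvPolynomial (Fin ℓ) ℂ) : Prop where
  degree_one : ∀ j, (f j).totalDegree = 1
  distinct : Function.Injective fun j => {x : Fin ℓ → ℂ | eval x (f j) = 0}

variable {ℓ n q : ℕ}

/-- The complement `U` of the arrangement. -/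
def compl (f : Fin n → MvPolynomial (Fin ℓ) ℂ) : Set (Fin ℓ → ℂ) :=
  {x | ∀ j, eval x (f j) ≠ 0}

/-- The logarithmic one-form `ω_lam = ∑ j, lam j • d log (f j)`; its value at `x` is a linear
functional on `ℂ ^ ℓ`. It is only used at points of the complement. -/
def logForm (f : Fin n → MvPolynomial (Fin ℓ) ℂ) (lam : Fin n → ℂ) (x : Fin ℓ → ℂ) :
    (Fin ℓ → ℂ) →L[ℂ] ℂ :=
  ∑ j, (lam j / eval x (f j)) • fderiv ℂ (fun y => eval y (f j)) x

/-- `Ψ` is, near `x`, a branch of the multivalued master function `Φ_lam = ∏ j, (f j) ^ (lam j)`: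
it is `exp (∑ j, lam j * g j)` where `g j` is a holomorphic logarithm of `f j` near `x`. -/
def IsBranchAt (f : Fin n → MvPolynomial (Fin ℓ) ℂ) (lam : Fin n → ℂ) (x : Fin ℓ → ℂ)
    (Ψ : (Fin ℓ → ℂ) → ℂ) : Prop :=
  ∃ g : Fin n → (Fin ℓ → ℂ) → ℂ,
    (∀ j, AnalyticAt ℂ (g j) x) ∧
    (∀ j, ∀ᶠ y in 𝓝 x, Complex.exp (g j y) = eval y (f j)) ∧
    ∀ᶠ y in 𝓝 x, Ψ y = Complex.exp (∑ j, lam j * g j y)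

/-- The critical locus of the multivalued master function `Φ_lam`: the points of the complement
at which the differential of a branch of `Φ_lam` vanishes. (By `mem_crit_iff` below the choice of
the branch is immaterial.) -/
def crit (f : Fin n → MvPolynomial (Fin ℓ) ℂ) (lam : Fin n → ℂ) : Set (Fin ℓ → ℂ) :=
  {x | x ∈ compl f ∧ ∃ Ψ, IsBranchAt f lam x Ψ ∧ fderiv ℂ Ψ x = 0}

theorem analyticAt_eval (p : MvPolynomial (Fin ℓ) ℂ) (x : Fin ℓ → ℂ) :
    AnalyticAt ℂ (fun y : Fin ℓ → ℂ => eval y p) x := by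
  have h : ∀ i : Fin ℓ, AnalyticAt ℂ (fun y : Fin ℓ → ℂ => y i) x := fun i =>
    (ContinuousLinearMap.proj (R := ℂ) (φ := fun _ : Fin ℓ => ℂ) i).analyticAt x
  simpa [MvPolynomial.aeval_eq_eval] using AnalyticAt.aeval_mvPolynomial h p

/-- A branch `Ψ` satisfies `dΨ = Ψ • ω_lam`. -/
theorem IsBranchAt.fderiv_eq {f : Fin n → MvPolynomial (Fin ℓ) ℂ} {lam : Fin n → ℂ}
    {x : Fin ℓ → ℂ} {Ψ : (Fin ℓ → ℂ) → ℂ} (h : IsBranchAt f lam x Ψ) :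
    Ψ x ≠ 0 ∧ fderiv ℂ Ψ x = Ψ x • logForm f lam x := by
  obtain ⟨g, hg, hexp, hΨ⟩ := h
  have hΨx : Ψ x = Complex.exp (∑ j, lam j * g j x) := hΨ.self_of_nhds
  have hgx : ∀ j, Complex.exp (g j x) = eval x (f j) := fun j => (hexp j).self_of_nhds
  refine ⟨by rw [hΨx]; exact Complex.exp_ne_zero _, ?_⟩
  have hd : ∀ j, HasFDerivAt (g j) (fderiv ℂ (g j) x) x := fun j =>
    (hg j).differentiableAt.hasFDerivAt
  have hf : ∀ j, fderiv ℂ (fun y => eval y (f j)) x = eval x (f j) • fderiv ℂ (g j) x := by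
    intro j
    have h1 := (hd j).cexp
    rw [hgx j] at h1
    exact (h1.congr_of_eventuallyEq ((hexp j).mono fun y hy => hy.symm)).fderiv
  have hsum : HasFDerivAt (fun y => ∑ j, lam j * g j y) (∑ j, lam j • fderiv ℂ (g j) x) x :=
    HasFDerivAt.fun_sum fun j _ => (hd j).const_mul (lam j)
  have h2 := hsum.cexp
  rw [← hΨx] at h2
  rw [(h2.congr_of_eventuallyEq hΨ).fderiv, logForm]
  congr 1
  refine Finset.sum_congr rfl fun j _ => ?_
  have hne : eval x (f j) ≠ 0 := by rw [← hgx j]; exact Complex.exp_ne_zero _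
  rw [hf j, smul_smul, div_mul_cancel₀ _ hne]

theorem exists_isBranchAt (f : Fin n → MvPolynomial (Fin ℓ) ℂ) (lam : Fin n → ℂ)
    {x : Fin ℓ → ℂ} (hx : x ∈ compl f) : ∃ Ψ, IsBranchAt f lam x Ψ := by
  refine ⟨_, fun j y => Complex.log (eval y (f j) / eval x (f j)) + Complex.log (eval x (f j)),
    fun j => ?_, fun j => ?_, Filter.Eventually.of_forall fun y => rfl⟩
  · refine AnalyticAt.add (AnalyticAt.clog ?_ ?_) analyticAt_const
    · exact (analyticAt_eval (f j) x).div_const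
    · simp [div_self (hx j)]
  · have hc := (analyticAt_eval (f j) x).continuousAt
    filter_upwards [hc.eventually_ne (hx j)] with y hy
    rw [Complex.exp_add, Complex.exp_log (div_ne_zero hy (hx j)), Complex.exp_log (hx j),
      div_mul_cancel₀ _ (hx j)]

/-- The critical locus of `Φ_lam` is the zero locus in the complement of `ω_lam = d log Φ_lam`. -/
theorem mem_crit_iff (f : Fin n → MvPolynomial (Fin ℓ) ℂ) (lam : Fin n → ℂ) (x : Fin ℓ → ℂ) :
    x ∈ crit f lam ↔ x ∈ compl f ∧ logForm f lam x = 0 := by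
  refine and_congr_right fun hx => ⟨?_, fun h => ?_⟩
  · rintro ⟨Ψ, hΨ, h0⟩
    obtain ⟨hne, hd⟩ := hΨ.fderiv_eq
    rw [h0] at hd
    exact (smul_eq_zero.mp hd.symm).resolve_left hne
  · obtain ⟨Ψ, hΨ⟩ := exists_isBranchAt f lam hx
    exact ⟨Ψ, hΨ, ContinuousLinearMap.ext fun v => by
      rw [hΨ.fderiv_eq.2, h]; exact mul_zero (Ψ x)⟩

/-! ### Zariski topologies, components, codimension -/

/-- The Zariski topology on `ℂ ^ ℓ`, with the sets `p ≠ 0` as a basis. -/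
@[reducible] def zariskiAffine (ℓ : ℕ) : TopologicalSpace (Fin ℓ → ℂ) :=
  TopologicalSpace.generateFrom
    (Set.range fun p : MvPolynomial (Fin ℓ) ℂ => {x | eval x p ≠ 0})

/-- `Z` is an irreducible component of `S ⊆ ℂ ^ ℓ`, for the Zariski topology. -/
def IsComponent (S Z : Set (Fin ℓ → ℂ)) : Prop :=
  Maximal (fun T => T ⊆ S ∧ @IsIrreducible _ (zariskiAffine ℓ) T) Z

/-- The codimension of an irreducible locally closed `Z ⊆ ℂ ^ ℓ` (in `ℂ ^ ℓ`, equivalently in any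
Zariski-open set that contains it): the height of the prime ideal of polynomials that vanish
on `Z`. -/
def codim (Z : Set (Fin ℓ → ℂ)) : ℕ∞ :=
  (vanishingIdeal ℂ Z).height

/-- Complex projective space of dimension `q`, with homogeneous coordinates `z_0, …, z_q`. -/
abbrev ProjSpace (q : ℕ) : Type := ℙ ℂ (Fin (q + 1) → ℂ)

/-- The Zariski topology on projective space, with the sets `F ≠ 0`, for `F` a homogeneous
polynomial, as a basis. -/
@[reducible] def zariskiProj (q : ℕ) : TopologicalSpace (ProjSpace q) :=
  TopologicalSpace.generateFrom
    {D | ∃ (F : MvPolynomial (Fin (q + 1)) ℂ) (d : ℕ), F.IsHomogeneous d ∧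
      D = {p : ProjSpace q | eval p.rep F ≠ 0}}

/-- The (Krull) dimension of a subset of projective space, with the Zariski topology. -/
def projDim (W : Set (ProjSpace q)) : WithBot ℕ∞ :=
  @topologicalKrullDim W (@instTopologicalSpaceSubtype _ (· ∈ W) (zariskiProj q))

/-! ### The rational map of a system of integral weights -/

/-- The map `Φ_Λ = (Φ_{Λ 1}, …, Φ_{Λ q}) : U → ℂ ^ q`, where
`Φ_{Λ i} = ∏ j, (f j) ^ (Λ i j)`. -/
def mapΛ (f : Fin n → MvPolynomial (Fin ℓ) ℂ) (Λ : Fin q → Fin n → ℤ) (x : Fin ℓ → ℂ) :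
    Fin q → ℂ :=
  fun i => ∏ j, eval x (f j) ^ Λ i j

/-- Homogeneous coordinates `(1, Φ_{Λ 1}(x), …, Φ_{Λ q}(x))` of `Φ_Λ(x)`. -/
def homCoord (f : Fin n → MvPolynomial (Fin ℓ) ℂ) (Λ : Fin q → Fin n → ℤ) (x : Fin ℓ → ℂ) :
    Fin (q + 1) → ℂ :=
  Matrix.vecCons 1 (mapΛ f Λ x)

theorem homCoord_ne_zero (f : Fin n → MvPolynomial (Fin ℓ) ℂ) (Λ : Fin q → Fin n → ℤ)
    (x : Fin ℓ → ℂ) : homCoord f Λ x ≠ 0 := fun h => by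
  simpa [homCoord] using congrFun h 0

/-- The image `Y = Φ_Λ(U)`, as a subset of projective space. -/
def imageY (f : Fin n → MvPolynomial (Fin ℓ) ℂ) (Λ : Fin q → Fin n → ℤ) : Set (ProjSpace q) :=
  (fun x => Projectivization.mk ℂ (homCoord f Λ x) (homCoord_ne_zero f Λ x)) '' compl f

/-- The Zariski closure of `Y` in projective space. -/
def closureY (f : Fin n → MvPolynomial (Fin ℓ) ℂ) (Λ : Fin q → Fin n → ℤ) : Set (ProjSpace q) :=
  @closure _ (zariskiProj q) (imageY f Λ)

/-- The homogeneous ideal of `Y` and of its closure: it is generated by the homogeneous `F` with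
`F(1, Φ_{Λ 1}, …, Φ_{Λ q}) = 0` on `U`. -/
def syzygyIdeal (f : Fin n → MvPolynomial (Fin ℓ) ℂ) (Λ : Fin q → Fin n → ℤ) :
    Ideal (MvPolynomial (Fin (q + 1)) ℂ) :=
  Ideal.span {F | (∃ d, F.IsHomogeneous d) ∧ ∀ x ∈ compl f, eval (homCoord f Λ x) F = 0}

/-- The closure of `Y` is the hypersurface `P = 0`: its homogeneous ideal is generated by the
nonzero homogeneous polynomial `P`. -/
def IsHypersurfaceOf (f : Fin n → MvPolynomial (Fin ℓ) ℂ) (Λ : Fin q → Fin n → ℤ)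
    (P : MvPolynomial (Fin (q + 1)) ℂ) : Prop :=
  P ≠ 0 ∧ (∃ d, P.IsHomogeneous d) ∧ syzygyIdeal f Λ = Ideal.span {P}

/-- `Φ_Λ` is nonsingular on `U`, where `r` is the dimension of the image: its Jacobian has
rank `r` at every point of `U`. -/
def IsNonsingularMap (f : Fin n → MvPolynomial (Fin ℓ) ℂ) (Λ : Fin q → Fin n → ℤ) (r : ℕ) :
    Prop :=
  ∀ x ∈ compl f, Module.finrank ℂ (LinearMap.range (fderiv ℂ (mapΛ f Λ) x).toLinearMap) = r

/-! ### Projective hypersurfaces and the coordinate hyperplanes -/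

/-- The gradient `(∂_0 P(z), …, ∂_q P(z))`. -/
def grad (P : MvPolynomial (Fin (q + 1)) ℂ) (z : Fin (q + 1) → ℂ) : Fin (q + 1) → ℂ :=
  fun i => eval z (pderiv i P)

/-- The hypersurface `W` with homogeneous ideal `(P)` is nonsingular (Jacobian criterion). -/
def IsNonsingularHypersurface (P : MvPolynomial (Fin (q + 1)) ℂ) (W : Set (ProjSpace q)) : Prop :=
  ∀ y ∈ W, grad P y.rep ≠ 0

/-- The hypersurface `W` with homogeneous ideal `(P)` meets the coordinate hyperplanes
transversely: at each `y ∈ W`, the conormal vectors at `y` of `W` and of all the coordinate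
hyperplanes `z_i = 0` through `y` are linearly independent. -/
def MeetsCoordTransversely (P : MvPolynomial (Fin (q + 1)) ℂ) (W : Set (ProjSpace q)) : Prop :=
  ∀ y ∈ W, LinearIndependent ℂ
    (fun o : Option {i : Fin (q + 1) // y.rep i = 0} =>
      o.elim (grad P y.rep) (fun i => (Pi.single (i : Fin (q + 1)) (1 : ℂ) : Fin (q + 1) → ℂ)))

/-- The vector `(z_0 ∂_0 P(z), …, z_q ∂_q P(z))`. -/
def rhoVec (P : MvPolynomial (Fin (q + 1)) ℂ) (z : Fin (q + 1) → ℂ) : Fin (q + 1) → ℂ :=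
  fun i => z i * grad P z i

/-- The image `ρ(W)` of `W` under the rational map `ρ = [z_0 ∂_0 P : … : z_q ∂_q P]`. -/
def rhoImage (P : MvPolynomial (Fin (q + 1)) ℂ) (W : Set (ProjSpace q)) : Set (ProjSpace q) :=
  {w | ∃ y ∈ W, ∃ h : rhoVec P y.rep ≠ 0, w = Projectivization.mk ℂ (rhoVec P y.rep) h}

/-- The torus `(ℂ^*) ^ q` in projective space: all homogeneous coordinates are nonzero. -/
def torus (q : ℕ) : Set (ProjSpace q) :=
  {p | ∀ i, p.rep i ≠ 0}

end MasterFunction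

end

/-! On `U` the form `d log Φ` is the pullback under `Φ_Λ` of `∑ a_i d log (z_i / z_0)`. By the rank
hypothesis the differential of `Φ_Λ` maps onto the tangent space of the hypersurface `P = 0`, so a
point is critical exactly when the covector `(a_i / y_i)` at its image `y` is a multiple of the
affine gradient of `P`. Multiplying by `y_i`, and recovering the zeroth coordinate from Euler's
formula, this says `ρ(y) = [a_0 : ⋯ : a_q]` (`IsHypersurfaceOf.mem_crit_iff`). Thus the critical
locus is the preimage under `Φ_Λ` of one fibre of `ρ`. Transversality makes `ρ` defined on the whole
hypersurface (`IsHypersurfaceOf.rhoVec_ne_zero`).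

Nonemptiness: by Euler, `ρ` takes values in the hyperplane of coordinate sum zero, so one
proportionality equation is redundant. With `P` there remain `q` homogeneous equations in `q + 1`
unknowns, which have a nonzero solution. Since no `a_k` vanishes, no coordinate of the solution
does, so it lies in the torus and hence in `Φ_Λ(U)`.

Codimension at most `q - 1`: the same `q - 1` equations, pulled back to `U`, cut out the critical
locus, and Krull's height theorem applies. Codimension at least `q - 1`: since `a_0 ≠ 0`, the fibre
of `ρ` misses `z_0 = 0`; a projective set inside an affine chart is finite
(`finite_zeroLocus_inter_chart`). Hence `Φ_Λ` is constant on each component, and its Jacobian rank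
bounds the height from below (`Ideal.le_height_of_det_derivation`, a Jacobian criterion in
characteristic zero). -/

/-! ### Lower bounds for heights from derivations -/

/-- No product `s * g ^ k` with `s ∉ p` can lie in `J`: differentiating would lower the power of `g`
until some element outside `p` lay in `J`. A prime containing `J` and disjoint from the monoid
generated by `g` and the complement of `p` is then as required. -/
theorem Ideal.exists_isPrime_le_of_derivation {K R : Type*} [Field K] [CharZero K] [CommRing R]
    [Algebra K R] {p J : Ideal R} [p.IsPrime] (hJ : J ≤ p) {g : R} (D : Derivation K R R)
    (hD : ∀ x ∈ J, D x ∈ J) (hg : D g ∉ p) :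
    ∃ q : Ideal R, q.IsPrime ∧ J ≤ q ∧ q ≤ p ∧ g ∉ q := by
  have key : ∀ (k : ℕ) (s : R), s ∉ p → s * g ^ k ∉ J := by
    intro k
    induction k with
    | zero => intro s hs h; exact hs (hJ (by simpa using h))
    | succ k ih =>
      intro s hs h
      -- The combination `s * D x - D s * x`, for `x = s * g ^ (k + 1)`, cancels the term with `D s`
      -- and leaves `(k + 1) * s ^ 2 * D g * g ^ k`. Characteristic zero keeps the factor `k + 1`
      -- outside `p`.
      have h1 := J.mul_mem_left s (hD _ h)
      have h2 := J.mul_mem_left (D s) h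
      have h3 : (s * s * ((k + 1 : ℕ) : R) * D g) * g ^ k ∈ J := by
        convert J.sub_mem h1 h2 using 1
        simp only [Derivation.leibniz, Derivation.leibniz_pow, smul_eq_mul, nsmul_eq_mul,
          Nat.add_sub_cancel]
        ring
      refine ih _ ?_ h3
      have hk : ((k + 1 : ℕ) : R) ∉ p := by
        intro hmem
        refine Ideal.IsPrime.ne_top ‹_› (Ideal.eq_top_of_isUnit_mem p hmem ?_)
        have : ((k + 1 : ℕ) : R) = algebraMap K R ((k + 1 : ℕ) : K) := by simp
        rw [this]
        exact (IsUnit.mk0 _ (Nat.cast_ne_zero.2 k.succ_ne_zero)).map _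
      intro hmem
      rcases Ideal.IsPrime.mem_or_mem ‹_› hmem with hmem | hmem
      · rcases Ideal.IsPrime.mem_or_mem ‹_› hmem with hmem | hmem
        · rcases Ideal.IsPrime.mem_or_mem ‹_› hmem with hmem | hmem <;> exact hs hmem
        · exact hk hmem
      · exact hg hmem
  have hdisj : Disjoint (J : Set R) (p.primeCompl ⊔ Submonoid.powers g : Submonoid R) := by
    rw [Set.disjoint_left]
    intro x hx hxM
    obtain ⟨s, hs, _, ⟨k, rfl⟩, rfl⟩ := Submonoid.mem_sup.1 hxM
    exact key k s hs hx
  obtain ⟨q, hq, hJq, hqM⟩ := Ideal.exists_le_prime_disjoint J _ hdisj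
  rw [Set.disjoint_left] at hqM
  refine ⟨q, hq, hJq, fun x hx => ?_, fun hgq => ?_⟩
  · by_contra hxp
    exact hqM hx (Submonoid.mem_sup_left (S := p.primeCompl) hxp)
  · exact hqM hgq (Submonoid.mem_sup_right (Submonoid.mem_powers g))

theorem Derivation.sum_apply {K R ι : Type*} [CommSemiring K] [CommSemiring R] [Algebra K R]
    (s : Finset ι) (D : ι → Derivation K R R) (h : R) : (∑ i ∈ s, D i) h = ∑ i ∈ s, D i h := by
  classical
  induction s using Finset.induction_on with
  | empty => simp
  | insert i s hi ih => simp [Finset.sum_insert hi, ih]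

/-- If `r` elements of a prime `p` have a Jacobian determinant, with respect to some derivations,
that is not in `p`, then `p` has height at least `r`. -/
theorem Ideal.le_height_of_det_derivation {K R : Type*} [Field K] [CharZero K] [CommRing R]
    [Algebra K R] (r : ℕ) (p : Ideal R) [p.IsPrime] (g : Fin r → R) (D : Fin r → Derivation K R R)
    (hg : ∀ i, g i ∈ p) (hdet : (Matrix.of fun i j => D j (g i)).det ∉ p) :
    (r : ℕ∞) ≤ p.height := by
  induction r generalizing p with
  | zero => simp
  | succ r ih =>
    let M : Fin (r + 1) → R := fun j =>
      (Matrix.of fun i k => D (j.succAbove k) (g (Fin.succ i))).det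
    -- Cofactor expansion along the first row: `E h` is the Jacobian determinant with `g 0` replaced
    -- by `h`. So `E` kills every later `g i`, preserves the ideal they generate, and sends `g 0`
    -- outside `p`.
    let E : Derivation K R R := ∑ j : Fin (r + 1), ((-1) ^ (j : ℕ) * M j) • D j
    have hE : ∀ h : R, E h = (Matrix.of
        fun i j => D j ((Fin.cons h (fun i => g (Fin.succ i)) : Fin (r + 1) → R) i)).det := by
      intro h
      rw [Matrix.det_succ_row_zero]
      simp only [E, Derivation.sum_apply, Derivation.coe_smul, Pi.smul_apply,
        smul_eq_mul]
      refine Finset.sum_congr rfl fun j _ => ?_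
      have : (Matrix.of fun i j => D j ((Fin.cons h (fun i => g (Fin.succ i)) :
          Fin (r + 1) → R) i)).submatrix Fin.succ j.succAbove =
          Matrix.of fun i k => D (j.succAbove k) (g (Fin.succ i)) := by
        ext i k; simp
      rw [this]
      simp only [Matrix.of_apply, Fin.cons_zero, M]
      ring
    have hE0 : E (g 0) = (Matrix.of fun i j => D j (g i)).det := by
      rw [hE]
      congr 2
      ext i j
      refine Fin.cases ?_ (fun i => ?_) i <;> simp
    have hEs : ∀ i : Fin r, E (g i.succ) = 0 := by
      intro i
      rw [hE]
      refine Matrix.det_zero_of_row_eq (i := 0) (j := i.succ) (Fin.succ_ne_zero i).symm ?_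
      ext j; simp
    -- A minor outside `p` is also outside the smaller prime found below, so the induction continues
    -- there.
    obtain ⟨j, hj⟩ : ∃ j, M j ∉ p := by
      by_contra! hM
      refine hdet (hE0 ▸ ?_)
      simp only [E, Derivation.sum_apply, Derivation.coe_smul, Pi.smul_apply,
        smul_eq_mul]
      exact p.sum_mem fun j _ => p.mul_mem_right _ (p.mul_mem_left _ (hM j))
    have hJ : Ideal.span (Set.range fun i : Fin r => g i.succ) ≤ p :=
      Ideal.span_le.2 (by rintro _ ⟨i, rfl⟩; exact hg _)
    have hEJ : ∀ x ∈ Ideal.span (Set.range fun i : Fin r => g i.succ),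
        E x ∈ Ideal.span (Set.range fun i : Fin r => g i.succ) := by
      intro x hx
      induction hx using Submodule.span_induction with
      | mem x hx => obtain ⟨i, rfl⟩ := hx; simp [hEs]
      | zero => simp
      | add x y _ _ hx hy => rw [map_add]; exact Ideal.add_mem _ hx hy
      | smul a x hx' hx =>
        rw [smul_eq_mul, Derivation.leibniz]
        exact Ideal.add_mem _ (Ideal.mul_mem_left _ _ hx) (Ideal.mul_mem_right _ _ hx')
    obtain ⟨q, hq, hJq, hqp, hgq⟩ :=
      Ideal.exists_isPrime_le_of_derivation hJ E hEJ (hE0 ▸ hdet : E (g 0) ∉ p)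
    have hlt : q < p := lt_of_le_of_ne hqp fun h => hgq (h ▸ hg 0)
    have h1 : (r : ℕ∞) ≤ q.height :=
      ih q (fun i => g i.succ) (fun k => D (j.succAbove k))
        (fun i => hJq (Ideal.subset_span ⟨i, rfl⟩)) fun h => hj (hqp h)
    calc ((r + 1 : ℕ) : ℕ∞) = r + 1 := by push_cast; rfl
      _ ≤ q.height + 1 := by gcongr
      _ ≤ p.height := Ideal.height_add_one_le_of_lt_of_isPrime hlt

theorem Ideal.height_le_of_mem_minimalPrimes_span_range {R : Type*} [CommRing R]
    [IsNoetherianRing R] {r : ℕ} {F : Fin r → R} {p : Ideal R}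
    (hp : p ∈ (Ideal.span (Set.range F)).minimalPrimes) : p.height ≤ r := by
  classical
  have h : ((Finset.univ.image F : Finset R) : Set R) = Set.range F := by simp
  rw [← h] at hp
  refine (Ideal.height_le_card_of_mem_minimalPrimes_span_finset hp).trans ?_
  exact_mod_cast Finset.card_image_le.trans (by simp)

/-! ### Zero loci of polynomial systems -/

/-- Fewer polynomials than variables, all vanishing at the origin, have another common zero. -/
theorem MvPolynomial.exists_ne_zero_forall_eval_eq_zero {K : Type*} [Field K] [CharZero K]
    [IsAlgClosed K] {m r : ℕ} (hr : r < m) (F : Fin r → MvPolynomial (Fin m) K)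
    (hF : ∀ i, eval 0 (F i) = 0) : ∃ z : Fin m → K, z ≠ 0 ∧ ∀ i, eval z (F i) = 0 := by
  by_contra! hz
  -- If the origin were the only common zero, the maximal ideal `p` of the origin would be the
  -- radical of the ideal of the system: height at least `m` by the coordinate Jacobian, at most `r`
  -- by Krull.
  let p : Ideal (MvPolynomial (Fin m) K) := vanishingIdeal K {(0 : Fin m → K)}
  have hp : ∀ g, g ∈ p ↔ eval 0 g = 0 := fun g => by
    simp [p, MvPolynomial.aeval_eq_eval]
  have h1 : (m : ℕ∞) ≤ p.height := by
    refine Ideal.le_height_of_det_derivation (K := K) m p X (fun j => pderiv j)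
      (fun i => by rw [hp]; simp) ?_
    have : (Matrix.of fun i j : Fin m => (pderiv j) (X i : MvPolynomial (Fin m) K)) = 1 := by
      ext1 i j
      simp [pderiv_X, Pi.single_apply, Matrix.one_apply]
    rw [this, Matrix.det_one, hp]
    simp
  have hle : Ideal.span (Set.range F) ≤ p :=
    Ideal.span_le.2 (by rintro _ ⟨i, rfl⟩; exact (hp _).2 (hF i))
  have hrad : (Ideal.span (Set.range F)).radical = p := by
    rw [← vanishingIdeal_zeroLocus_eq_radical (K := K), zeroLocus_span]
    congr 1
    ext z
    simp only [Set.forall_mem_range, Set.mem_ofPred_eq, Set.mem_singleton_iff,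
      MvPolynomial.aeval_eq_eval]
    refine ⟨fun h => ?_, fun h => h ▸ hF⟩
    by_contra h0
    obtain ⟨i, hi⟩ := hz z h0
    exact hi (h i)
  have hmin : p ∈ (Ideal.span (Set.range F)).minimalPrimes := by
    refine ⟨⟨inferInstance, hle⟩, fun q hq _ => ?_⟩
    rw [← hrad]
    exact hq.1.radical_le_iff.2 hq.2
  have h4 := h1.trans (Ideal.height_le_of_mem_minimalPrimes_span_range hmin)
  exact absurd (by exact_mod_cast h4) (not_le.2 hr)

theorem MvPolynomial.IsHomogeneous.eval_smul {σ K : Type*} [CommSemiring K]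
    {F : MvPolynomial σ K} {d : ℕ} (hF : F.IsHomogeneous d) (c : K) (z : σ → K) :
    eval (c • z) F = c ^ d * eval z F := by
  rw [eval_eq, eval_eq, Finset.mul_sum]
  refine Finset.sum_congr rfl fun s hs => ?_
  have hd : ∑ i ∈ s.support, s i = d := (hF.degree_eq_sum_deg_support hs).symm
  rw [← hd, ← Finset.prod_pow_eq_pow_sum]
  simp only [Pi.smul_apply, smul_eq_mul, mul_pow, Finset.prod_mul_distrib]
  ring

theorem MvPolynomial.homogeneousComponent_X_mul {σ K : Type*} [CommSemiring K] (i : σ)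
    (h : MvPolynomial σ K) (N : ℕ) :
    homogeneousComponent (N + 1) (X i * h) = X i * homogeneousComponent N h := by
  classical
  ext s
  rw [coeff_homogeneousComponent, coeff_X_mul', coeff_X_mul', coeff_homogeneousComponent]
  by_cases hi : i ∈ s.support
  · have hs : s - Finsupp.single i 1 + Finsupp.single i 1 = s :=
      tsub_add_cancel_of_le (Finsupp.single_le_iff.2 (Nat.one_le_iff_ne_zero.2
        (Finsupp.mem_support_iff.1 hi)))
    have hdeg : (s - Finsupp.single i 1).degree + 1 = s.degree := by
      rw [← congrArg Finsupp.degree hs, map_add, Finsupp.degree_single]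
    simp only [hi, if_true, ← hdeg, Nat.add_right_cancel_iff]
  · simp [hi]

/-- A homogeneous ideal whose projective zero locus does not meet `z_0 = 0` has a finite zero
locus in the chart `z_0 = 1`. -/
theorem MvPolynomial.finite_zeroLocus_inter_chart {K : Type*} [Field K] [IsAlgClosed K] {m : ℕ}
    (I : Ideal (MvPolynomial (Fin (m + 1)) K)) (hI : ∀ p ∈ I, ∀ n, homogeneousComponent n p ∈ I)
    (h0 : ∀ z ∈ zeroLocus K I, z 0 = 0 → z = 0) : {z ∈ zeroLocus K I | z 0 = 1}.Finite := by
  have hN : ∀ i, ∃ (N : ℕ) (h : MvPolynomial (Fin (m + 1)) K), h.IsHomogeneous N ∧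
      X i ^ (N + 1) - X 0 * h ∈ I := by
    intro i
    -- By the Nullstellensatz some power of `X i` lies in `I + (X 0)`; its homogeneous component
    -- gives a relation `X i ^ (N + 1) ≡ X 0 * h` with `h` of degree `N`. In the chart `X 0 = 1`
    -- this lowers degrees.
    have h1 : X i ∈ (I ⊔ Ideal.span {X 0}).radical := by
      rw [← vanishingIdeal_zeroLocus_eq_radical (K := K)]
      intro z hz
      have hzI : z ∈ zeroLocus K I := zeroLocus_anti_mono le_sup_left hz
      have hz0 : z 0 = 0 := by
        simpa using hz (X 0) (Ideal.mem_sup_right (Ideal.mem_span_singleton_self _))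
      simp [h0 z hzI hz0]
    obtain ⟨N, hN⟩ := h1
    obtain ⟨g, hg, w, hw, hgw⟩ := Submodule.mem_sup.1 (Ideal.mul_mem_left _ (X i) hN)
    obtain ⟨h, rfl⟩ := Ideal.mem_span_singleton.1 hw
    refine ⟨N, homogeneousComponent N h, homogeneousComponent_isHomogeneous N h, ?_⟩
    have h2 := hI g hg (N + 1)
    rw [eq_sub_of_add_eq hgw, map_sub, ← pow_succ', homogeneousComponent_X_mul,
      homogeneousComponent_eq_self (by simpa using isHomogeneous_X_pow (R := K) i (N + 1))] at h2
    exact h2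
  choose N h hh hmem using hN
  let J : Ideal (MvPolynomial (Fin (m + 1)) K) := I ⊔ Ideal.span {X 0 - 1}
  let π := Ideal.Quotient.mkₐ K J
  have hπ0 : π (X 0) = 1 := by
    rw [← map_one π]
    exact Ideal.Quotient.eq.2 (Ideal.mem_sup_right (Ideal.mem_span_singleton_self _))
  have hπ : ∀ i, π (X i) ^ (N i + 1) = π (h i) := by
    intro i
    have : π (X i ^ (N i + 1)) = π (X 0 * h i) := Ideal.Quotient.eq.2 (Ideal.mem_sup_left (hmem i))
    rwa [map_pow, map_mul, hπ0, one_mul] at this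
  let D := ∑ i, N i
  let E := (restrictTotalDegree (Fin (m + 1)) K D).map π.toLinearMap
  have hmain : ∀ (k : ℕ) (p : MvPolynomial (Fin (m + 1)) K), p.IsHomogeneous k → π p ∈ E := by
    intro k
    induction k using Nat.strong_induction_on with
    | _ k ih =>
      intro p hp
      by_cases hk : k ≤ D
      · exact ⟨p, (mem_restrictTotalDegree _ _ _).2 (hp.totalDegree_le.trans hk), rfl⟩
      rw [p.as_sum, map_sum]
      refine Submodule.sum_mem _ fun s hs => ?_
      have hsk : s.degree = k := by
        rw [hp.degree_eq_sum_deg_support hs]; rfl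
      -- Pigeonhole: a monomial of degree above `D = ∑ N i` has some exponent exceeding `N i`, so it
      -- can be reduced. The quotient is therefore spanned in degrees at most `D`.
      obtain ⟨i, hi⟩ : ∃ i, N i + 1 ≤ s i := by
        by_contra! hlt
        refine hk ?_
        rw [← hsk, Finsupp.degree_eq_sum]
        exact Finset.sum_le_sum fun i _ => Nat.lt_succ_iff.1 (hlt i)
      have hs' : s - Finsupp.single i (N i + 1) + Finsupp.single i (N i + 1) = s :=
        tsub_add_cancel_of_le (Finsupp.single_le_iff.2 hi)
      have hdeg : (s - Finsupp.single i (N i + 1)).degree + (N i + 1) = k := by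
        rw [← hsk, ← congrArg Finsupp.degree hs', map_add, Finsupp.degree_single]
      have hmon : monomial s (coeff s p) =
          monomial (s - Finsupp.single i (N i + 1)) (coeff s p) * X i ^ (N i + 1) := by
        rw [X_pow_eq_monomial, monomial_mul, hs', mul_one]
      rw [hmon, map_mul, map_pow, hπ, ← map_mul]
      exact ih _ (by omega) _ ((isHomogeneous_monomial _ rfl).mul (hh i))
  have hfin : Module.Finite K (MvPolynomial (Fin (m + 1)) K ⧸ J) := by
    have hE : E = ⊤ := by
      refine eq_top_iff.2 fun b _ => ?_
      obtain ⟨p, rfl⟩ := Ideal.Quotient.mkₐ_surjective K J b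
      change π p ∈ E
      rw [← sum_homogeneousComponent p, map_sum]
      exact Submodule.sum_mem _ fun k _ => hmain k _ (homogeneousComponent_isHomogeneous k p)
    have : FiniteDimensional K (restrictTotalDegree (Fin (m + 1)) K D) := inferInstance
    rw [Module.finite_def, ← hE]
    exact Submodule.FG.map _ (Module.Finite.iff_fg.1 this)
  have hint : ∀ i, ∃ Q : Polynomial K, Q.Monic ∧ Q.aeval (π (X i)) = 0 := fun i =>
    Algebra.IsIntegral.isIntegral (R := K) (π (X i))
  choose Q hQ hQ0 using hint
  refine (Set.Finite.pi' fun i => (Q i).rootSet_finite K).subset ?_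
  rintro z ⟨hz, hz0⟩ i
  have hzJ : ∀ p ∈ J, aeval z p = 0 := by
    intro p hp
    obtain ⟨g, hg, w, hw, rfl⟩ := Submodule.mem_sup.1 hp
    obtain ⟨h, rfl⟩ := Ideal.mem_span_singleton.1 hw
    rw [map_add, hz g hg]
    simp [hz0]
  rw [Polynomial.mem_rootSet]
  refine ⟨(hQ i).ne_zero, ?_⟩
  have := congrArg (Ideal.Quotient.liftₐ J (aeval z) hzJ) (hQ0 i)
  rw [← Polynomial.aeval_algHom_apply, map_zero] at this
  simpa [π] using this

namespace MasterFunction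

/-! ### Irreducible sets in the Zariski topology -/

theorem exists_basic_of_isOpen {ℓ : ℕ} {u : Set (Fin ℓ → ℂ)} (hu : IsOpen[zariskiAffine ℓ] u)
    {x : Fin ℓ → ℂ} (hx : x ∈ u) :
    ∃ p : MvPolynomial (Fin ℓ) ℂ, eval x p ≠ 0 ∧ ∀ y, eval y p ≠ 0 → y ∈ u := by
  induction hu with
  | basic s hs => obtain ⟨p, rfl⟩ := hs; exact ⟨p, hx, fun _ h => h⟩
  | univ => exact ⟨1, by simp, fun _ _ => trivial⟩
  | inter s t _ _ hs ht =>
    obtain ⟨p, hp, hps⟩ := hs hx.1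
    obtain ⟨p', hp', hpt⟩ := ht hx.2
    refine ⟨p * p', by simp [hp, hp'], fun y hy => ?_⟩
    rw [map_mul] at hy
    exact ⟨hps y (left_ne_zero_of_mul hy), hpt y (right_ne_zero_of_mul hy)⟩
  | sUnion S _ ih =>
    obtain ⟨s, hs, hxs⟩ := hx
    obtain ⟨p, hp, hps⟩ := ih s hs hxs
    exact ⟨p, hp, fun y hy => ⟨s, hs, hps y hy⟩⟩

theorem isOpen_basic {ℓ : ℕ} (p : MvPolynomial (Fin ℓ) ℂ) :
    IsOpen[zariskiAffine ℓ] {x | eval x p ≠ 0} :=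
  TopologicalSpace.GenerateOpen.basic _ ⟨p, rfl⟩

theorem isPrime_vanishingIdeal {ℓ : ℕ} {Z : Set (Fin ℓ → ℂ)}
    (hZ : @IsIrreducible _ (zariskiAffine ℓ) Z) : (vanishingIdeal ℂ Z).IsPrime := by
  refine Ideal.isPrime_iff.2 ⟨fun h => ?_, fun {p p'} hpp' => ?_⟩
  · obtain ⟨z, hz⟩ := hZ.1
    have := (Ideal.eq_top_iff_one _).1 h z hz
    simp at this
  · by_contra! hne
    simp only [mem_vanishingIdeal_iff, aeval_eq_eval, not_forall] at hne
    obtain ⟨⟨x, hx, hpx⟩, ⟨y, hy, hpy⟩⟩ := hne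
    obtain ⟨z, hz, hz1, hz2⟩ := hZ.2 _ _ (isOpen_basic p) (isOpen_basic p') ⟨x, hx, hpx⟩
      ⟨y, hy, hpy⟩
    have := hpp' z hz
    rw [aeval_eq_eval, map_mul] at this
    exact mul_ne_zero hz1 hz2 this

/-- For a prime `p` that does not contain `h`, a polynomial that vanishes on the zero locus of `p`
off `h = 0` is in `p`. -/
theorem mem_of_forall_eval_eq_zero {ℓ : ℕ} {p : Ideal (MvPolynomial (Fin ℓ) ℂ)} [p.IsPrime]
    {h : MvPolynomial (Fin ℓ) ℂ} (hh : h ∉ p) {g : MvPolynomial (Fin ℓ) ℂ}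
    (hg : ∀ x ∈ zeroLocus ℂ p, eval x h ≠ 0 → eval x g = 0) : g ∈ p := by
  refine (Ideal.IsPrime.mem_or_mem ‹_› (?_ : h * g ∈ p)).resolve_left hh
  rw [← IsPrime.vanishingIdeal_zeroLocus (K := ℂ) p]
  intro x hx
  rw [aeval_eq_eval, map_mul]
  by_cases hxh : eval x h = 0
  · simp [hxh]
  · simp [hg x hx hxh]

theorem isIrreducible_zeroLocus_inter {ℓ : ℕ} {p : Ideal (MvPolynomial (Fin ℓ) ℂ)} [p.IsPrime]
    {h : MvPolynomial (Fin ℓ) ℂ} (hh : h ∉ p) :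
    @IsIrreducible _ (zariskiAffine ℓ) {x | x ∈ zeroLocus ℂ p ∧ eval x h ≠ 0} := by
  constructor
  · by_contra hne
    refine hh (mem_of_forall_eval_eq_zero hh fun x hx hxh => ?_)
    exact absurd ⟨x, hx, hxh⟩ hne
  · rintro u v hu hv ⟨x, ⟨hx, hxh⟩, hxu⟩ ⟨y, ⟨hy, hyh⟩, hyv⟩
    obtain ⟨s, hs, hsu⟩ := exists_basic_of_isOpen hu hxu
    obtain ⟨t, ht, htv⟩ := exists_basic_of_isOpen hv hyv
    by_contra hne
    have hst : s * t ∈ p := by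
      refine mem_of_forall_eval_eq_zero hh fun z hz hzh => ?_
      by_contra hst
      rw [map_mul] at hst
      exact hne ⟨z, ⟨hz, hzh⟩, hsu z (left_ne_zero_of_mul hst), htv z (right_ne_zero_of_mul hst)⟩
    rcases Ideal.IsPrime.mem_or_mem ‹_› hst with h1 | h1
    · exact hs (by simpa [aeval_eq_eval] using hx s h1)
    · exact ht (by simpa [aeval_eq_eval] using hy t h1)

/-- A component of the locus `G_1 = ⋯ = G_r = 0`, `h ≠ 0` has codimension at most `r`. -/
theorem codim_le_of_isComponent {ℓ r : ℕ} {h : MvPolynomial (Fin ℓ) ℂ}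
    {G : Fin r → MvPolynomial (Fin ℓ) ℂ} {S Z : Set (Fin ℓ → ℂ)}
    (hS : ∀ x, x ∈ S ↔ eval x h ≠ 0 ∧ ∀ i, eval x (G i) = 0) (hZ : IsComponent S Z) :
    codim Z ≤ r := by
  obtain ⟨⟨hZS, hZirr⟩, hmax⟩ := hZ
  have := isPrime_vanishingIdeal hZirr
  refine Ideal.height_le_of_mem_minimalPrimes_span_range (F := G) ⟨⟨this, ?_⟩, ?_⟩
  · rw [Ideal.span_le]
    rintro _ ⟨i, rfl⟩ x hx
    rw [aeval_eq_eval]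
    exact ((hS x).1 (hZS hx)).2 i
  · rintro p ⟨hp, hGp⟩ hpZ
    have hh : h ∉ p := by
      intro hhp
      obtain ⟨z, hz⟩ := hZirr.1
      exact ((hS z).1 (hZS hz)).1 (by simpa [aeval_eq_eval] using hpZ hhp z hz)
    intro g hg
    refine mem_of_forall_eval_eq_zero hh fun x hx hxh => ?_
    -- The locus of `p` off `h = 0` is an irreducible part of `S` containing `Z`, so maximality
    -- makes it equal to `Z`.
    have hle : {x | x ∈ zeroLocus ℂ p ∧ eval x h ≠ 0} ⊆ Z := by
      refine hmax ⟨fun y hy => (hS y).2 ⟨hy.2, fun i => ?_⟩, isIrreducible_zeroLocus_inter hh⟩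
        fun y hy => ⟨fun s hs => hpZ hs y hy, ((hS y).1 (hZS hy)).1⟩
      simpa [aeval_eq_eval] using hy.1 _ (hGp (Ideal.subset_span ⟨i, rfl⟩))
    simpa [aeval_eq_eval] using hg x (hle ⟨hx, hxh⟩)

end MasterFunction

theorem MvPolynomial.homogeneousComponent_mem_span {σ K : Type*} [CommSemiring K]
    {S : Set (MvPolynomial σ K)} (hS : ∀ F ∈ S, ∃ d, F.IsHomogeneous d) :
    ∀ p ∈ Ideal.span S, ∀ n, homogeneousComponent n p ∈ Ideal.span S := by
  let := MvPolynomial.gradedAlgebra (σ := σ) (R := K)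
  intro p hp n
  refine homogeneousComponent_mem_of_mem (Ideal.homogeneous_span _ S fun F hF => ?_) hp n
  obtain ⟨d, hd⟩ := hS F hF
  exact ⟨d, hd⟩

namespace MasterFunction

variable {ℓ n q : ℕ}

theorem hasFDerivAt_eval (p : MvPolynomial (Fin ℓ) ℂ) (x : Fin ℓ → ℂ) :
    HasFDerivAt (fun y : Fin ℓ → ℂ => eval y p) (fderiv ℂ (fun y => eval y p) x) x :=
  (analyticAt_eval p x).differentiableAt.hasFDerivAt

theorem fderiv_eval_apply (p : MvPolynomial (Fin ℓ) ℂ) (x v : Fin ℓ → ℂ) :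
    fderiv ℂ (fun y : Fin ℓ → ℂ => eval y p) x v = ∑ i, eval x (pderiv i p) * v i := by
  induction p using MvPolynomial.induction_on with
  | C a => simp
  | add p q hp hq =>
    have h := ((hasFDerivAt_eval p x).fun_add (hasFDerivAt_eval q x)).fderiv
    simp only [← map_add] at h
    rw [h]
    simp [hp, hq, add_mul, Finset.sum_add_distrib]
  | mul_X p i hp =>
    have h := ((hasFDerivAt_eval p x).fun_mul (hasFDerivAt_apply (𝕜 := ℂ) i x)).fderiv
    simp only [map_mul, eval_X]
    rw [h]
    simp [hp, pderiv_X, Pi.single_apply, Finset.mul_sum, Finset.sum_add_distrib, add_mul,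
      apply_ite, ite_mul, mul_assoc]

/-! ### The Zariski closure of the image -/

theorem exists_basic_of_isOpen_proj {u : Set (ProjSpace q)} (hu : IsOpen[zariskiProj q] u)
    {y : ProjSpace q} (hy : y ∈ u) :
    ∃ (F : MvPolynomial (Fin (q + 1)) ℂ) (d : ℕ), F.IsHomogeneous d ∧ eval y.rep F ≠ 0 ∧
      ∀ z : ProjSpace q, eval z.rep F ≠ 0 → z ∈ u := by
  induction hu with
  | basic s hs => obtain ⟨F, d, hF, rfl⟩ := hs; exact ⟨F, d, hF, hy, fun _ h => h⟩
  | univ => exact ⟨1, 0, isHomogeneous_one _ _, by simp, fun _ _ => trivial⟩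
  | inter s t _ _ hs ht =>
    obtain ⟨F, d, hF, hFy, hFs⟩ := hs hy.1
    obtain ⟨F', d', hF', hFy', hFt⟩ := ht hy.2
    refine ⟨F * F', d + d', hF.mul hF', by simp [hFy, hFy'], fun z hz => ?_⟩
    rw [map_mul] at hz
    exact ⟨hFs z (left_ne_zero_of_mul hz), hFt z (right_ne_zero_of_mul hz)⟩
  | sUnion S _ ih =>
    obtain ⟨s, hs, hys⟩ := hy
    obtain ⟨F, d, hF, hFy, hFs⟩ := ih s hs hys
    exact ⟨F, d, hF, hFy, fun z hz => ⟨s, hs, hFs z hz⟩⟩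

theorem exists_rep_eq {z : Fin (q + 1) → ℂ} (hz : z ≠ 0) :
    ∃ c : ℂ, c ≠ 0 ∧ (Projectivization.mk ℂ z hz).rep = c • z := by
  obtain ⟨c, hc⟩ := Projectivization.exists_smul_eq_mk_rep ℂ z hz
  exact ⟨c, c.ne_zero, hc.symm⟩

variable {f : Fin n → MvPolynomial (Fin ℓ) ℂ} {Λ : Fin q → Fin n → ℤ}
  {P : MvPolynomial (Fin (q + 1)) ℂ}

theorem IsHypersurfaceOf.eval_homCoord (hP : IsHypersurfaceOf f Λ P) {x : Fin ℓ → ℂ}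
    (hx : x ∈ compl f) : eval (homCoord f Λ x) P = 0 := by
  have hmem : P ∈ syzygyIdeal f Λ := hP.2.2 ▸ Ideal.mem_span_singleton_self P
  have hle : syzygyIdeal f Λ ≤ RingHom.ker (eval (homCoord f Λ x)) :=
    Ideal.span_le.2 fun F hF => hF.2 x hx
  exact hle hmem

/-- If a basic open set `F ≠ 0` around the point missed `Y`, then `F` would lie in the homogeneous
ideal of `Y`, hence be a multiple of `P` and vanish at the point. -/
theorem IsHypersurfaceOf.mk_mem_closureY (hP : IsHypersurfaceOf f Λ P) {z : Fin (q + 1) → ℂ}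
    (hz : z ≠ 0) (h : eval z P = 0) : Projectivization.mk ℂ z hz ∈ closureY f Λ := by
  obtain ⟨d, hd⟩ := hP.2.1
  refine (@mem_closure_iff _ (zariskiProj q) _ _).2 fun u hu hzu => ?_
  obtain ⟨F, e, hF, hFz, hFu⟩ := exists_basic_of_isOpen_proj hu hzu
  by_contra hne
  have hFI : F ∈ syzygyIdeal f Λ := by
    refine Ideal.subset_span ⟨⟨e, hF⟩, fun x hx => ?_⟩
    by_contra hFx
    refine hne ⟨Projectivization.mk ℂ _ (homCoord_ne_zero f Λ x), hFu _ ?_, ⟨x, hx, rfl⟩⟩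
    obtain ⟨c, hc, hrep⟩ := exists_rep_eq (homCoord_ne_zero f Λ x)
    rw [hrep, hF.eval_smul]
    exact mul_ne_zero (pow_ne_zero _ hc) hFx
  rw [hP.2.2] at hFI
  obtain ⟨g, rfl⟩ := Ideal.mem_span_singleton.1 hFI
  obtain ⟨c, hc, hrep⟩ := exists_rep_eq hz
  rw [hrep, map_mul, hd.eval_smul, h] at hFz
  simp at hFz

/-! ### The map `ρ` -/

theorem eval_X_mul_pderiv (P : MvPolynomial (Fin (q + 1)) ℂ) (z : Fin (q + 1) → ℂ)
    (k : Fin (q + 1)) : eval z (X k * pderiv k P) = rhoVec P z k := by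
  simp [rhoVec, grad]

/-- The exponent is the degree of `X k * pderiv k P`; truncation at `d = 0` is harmless, as the
derivatives then vanish. -/
theorem rhoVec_smul {d : ℕ} (hd : P.IsHomogeneous d) (c : ℂ) (z : Fin (q + 1) → ℂ) :
    rhoVec P (c • z) = c ^ (1 + (d - 1)) • rhoVec P z := by
  ext k
  rw [← eval_X_mul_pderiv, ((isHomogeneous_X ℂ k).mul hd.pderiv).eval_smul, eval_X_mul_pderiv]
  rfl

theorem sum_rhoVec {d : ℕ} (hd : P.IsHomogeneous d) (z : Fin (q + 1) → ℂ) :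
    ∑ k, rhoVec P z k = d * eval z P := by
  have h := congrArg (eval z) hd.sum_X_mul_pderiv
  simp only [map_sum, eval_X_mul_pderiv] at h
  rw [h]
  simp

/-- If every `z_k ∂_k P` vanished, the gradient would be supported on the coordinates with `z_k =
0`, that is, lie in the span of the conormals of the coordinate hyperplanes through the point,
against transversality. -/
theorem IsHypersurfaceOf.rhoVec_ne_zero (hP : IsHypersurfaceOf f Λ P)
    (htrans : MeetsCoordTransversely P (closureY f Λ)) {z : Fin (q + 1) → ℂ} (hz : z ≠ 0)
    (h : eval z P = 0) : rhoVec P z ≠ 0 := by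
  intro h0
  obtain ⟨d, hd⟩ := hP.2.1
  have hlin := htrans _ (hP.mk_mem_closureY hz h)
  obtain ⟨c, hc, hrep⟩ := exists_rep_eq hz
  set w := (Projectivization.mk ℂ z hz).rep
  have hw : ∀ k, w k * grad P w k = 0 := by
    intro k
    have := congrFun (rhoVec_smul hd c z) k
    rw [← hrep, h0] at this
    simpa [rhoVec] using this
  rw [linearIndependent_option] at hlin
  refine hlin.2 ?_
  simp only [Option.elim]
  have hg : grad P w = ∑ k, grad P w k • (Pi.single k (1 : ℂ) : Fin (q + 1) → ℂ) := by
    ext k; simp [Finset.sum_apply, Pi.single_apply]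
  rw [hg]
  refine Submodule.sum_mem _ fun k _ => ?_
  rcases mul_eq_zero.1 (hw k) with h1 | h1
  · exact Submodule.smul_mem _ _ (Submodule.subset_span ⟨⟨k, h1⟩, rfl⟩)
  · simp [h1]

/-! ### The differential of the map, and critical points -/

theorem isBranchAt_mapΛ (f : Fin n → MvPolynomial (Fin ℓ) ℂ) (Λ : Fin q → Fin n → ℤ)
    {x : Fin ℓ → ℂ} (hx : x ∈ compl f) (i : Fin q) :
    IsBranchAt f (fun j => (Λ i j : ℂ)) x (fun y => mapΛ f Λ y i) := by
  obtain ⟨_, g, hg, hexp, _⟩ := exists_isBranchAt f (fun j => (Λ i j : ℂ)) hx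
  refine ⟨g, hg, hexp, ?_⟩
  filter_upwards [Filter.eventually_all.2 hexp] with y hy
  simp only [Complex.exp_sum, Complex.exp_int_mul, hy, mapΛ]

theorem IsBranchAt.differentiableAt {lam : Fin n → ℂ} {x : Fin ℓ → ℂ} {Ψ : (Fin ℓ → ℂ) → ℂ}
    (h : IsBranchAt f lam x Ψ) : DifferentiableAt ℂ Ψ x := by
  obtain ⟨g, hg, -, hΨ⟩ := h
  refine DifferentiableAt.congr_of_eventuallyEq ?_ hΨ
  exact (DifferentiableAt.fun_sum fun j _ => (hg j).differentiableAt.const_mul (lam j)).cexp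

theorem mapΛ_ne_zero {x : Fin ℓ → ℂ} (hx : x ∈ compl f) (i : Fin q) : mapΛ f Λ x i ≠ 0 :=
  Finset.prod_ne_zero_iff.2 fun j _ => zpow_ne_zero _ (hx j)

theorem hasFDerivAt_mapΛ_apply {x : Fin ℓ → ℂ} (hx : x ∈ compl f) (i : Fin q) :
    HasFDerivAt (fun y => mapΛ f Λ y i)
      (mapΛ f Λ x i • logForm f (fun j => (Λ i j : ℂ)) x) x := by
  have h := isBranchAt_mapΛ f Λ hx i
  rw [← h.fderiv_eq.2]
  exact h.differentiableAt.hasFDerivAt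

theorem differentiableAt_mapΛ {x : Fin ℓ → ℂ} (hx : x ∈ compl f) :
    DifferentiableAt ℂ (mapΛ f Λ) x :=
  differentiableAt_pi.2 fun i => (hasFDerivAt_mapΛ_apply hx i).differentiableAt

theorem fderiv_mapΛ_apply {x : Fin ℓ → ℂ} (hx : x ∈ compl f) (v : Fin ℓ → ℂ) (i : Fin q) :
    fderiv ℂ (mapΛ f Λ) x v i =
      mapΛ f Λ x i * logForm f (fun j => (Λ i j : ℂ)) x v := by
  have h := (hasFDerivAt_pi'.1 (differentiableAt_mapΛ (Λ := Λ) hx).hasFDerivAt i).unique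
    (hasFDerivAt_mapΛ_apply hx i)
  simpa using congrArg (fun L => L v) h

theorem isOpen_compl (f : Fin n → MvPolynomial (Fin ℓ) ℂ) : IsOpen (compl f) := by
  have : compl f = ⋂ j, {x | eval x (f j) ≠ 0} := by ext; simp [compl]
  rw [this]
  exact isOpen_iInter_of_finite fun j => isOpen_ne_fun (MvPolynomial.continuous_eval _)
    continuous_const

/-- The differential of `Φ_Λ` maps to the tangent space of the hypersurface. -/
theorem IsHypersurfaceOf.sum_grad_mul_fderiv (hP : IsHypersurfaceOf f Λ P) {x : Fin ℓ → ℂ}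
    (hx : x ∈ compl f) (v : Fin ℓ → ℂ) :
    ∑ i : Fin q, grad P (homCoord f Λ x) i.succ * fderiv ℂ (mapΛ f Λ) x v i = 0 := by
  let L' : (Fin ℓ → ℂ) →L[ℂ] (Fin (q + 1) → ℂ) := ContinuousLinearMap.pi
    (Fin.cons 0 fun i => (ContinuousLinearMap.proj i).comp (fderiv ℂ (mapΛ f Λ) x))
  have h1 : HasFDerivAt (homCoord f Λ) L' x := by
    refine hasFDerivAt_pi.2 fun k => ?_
    refine Fin.cases ?_ (fun i => ?_) k
    · exact hasFDerivAt_const (1 : ℂ) x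
    · exact hasFDerivAt_pi'.1 (differentiableAt_mapΛ hx).hasFDerivAt i
  have h2 := (hasFDerivAt_eval P (homCoord f Λ x)).comp x h1
  have h3 : HasFDerivAt (fun y => eval (homCoord f Λ y) P) (0 : (Fin ℓ → ℂ) →L[ℂ] ℂ) x := by
    refine (hasFDerivAt_const (0 : ℂ) x).congr_of_eventuallyEq ?_
    filter_upwards [(isOpen_compl f).mem_nhds hx] with y hy
    exact hP.eval_homCoord hy
  have h4 := congrArg (fun L => L v) (h2.unique h3)
  simpa [fderiv_eval_apply, Fin.sum_univ_succ, L', grad] using h4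

/-- A point of the complement is critical if and only if `ρ` maps its image to
`[-∑ a_i : a_1 : ⋯ : a_q]`. -/
theorem IsHypersurfaceOf.mem_crit_iff (hP : IsHypersurfaceOf f Λ P)
    (htrans : MeetsCoordTransversely P (closureY f Λ)) (hnonsing : IsNonsingularMap f Λ (q - 1))
    {a : Fin q → ℂ} (ha0 : -∑ i, a i ≠ 0) {lam : Fin n → ℂ}
    (hlam : ∀ x ∈ compl f, logForm f lam x =
        ∑ i, a i • logForm f (fun j => (Λ i j : ℂ)) x) {x : Fin ℓ → ℂ} (hx : x ∈ compl f) :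
    x ∈ crit f lam ↔ ∀ k, (-∑ i, a i) * rhoVec P (homCoord f Λ x) k =
      (Matrix.vecCons (-∑ i, a i) a : Fin (q + 1) → ℂ) k * rhoVec P (homCoord f Λ x) 0 := by
  obtain ⟨d, hd⟩ := hP.2.1
  set y := homCoord f Λ x with hy
  have hρ : rhoVec P y ≠ 0 := hP.rhoVec_ne_zero htrans (homCoord_ne_zero f Λ x)
    (hP.eval_homCoord hx)
  have hsum : ∑ k, rhoVec P y k = 0 := by
    rw [sum_rhoVec hd, hP.eval_homCoord hx, mul_zero]
  rw [Fin.sum_univ_succ] at hsum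
  have hρs : ∀ i : Fin q, rhoVec P y i.succ = mapΛ f Λ x i * grad P y i.succ := fun i => rfl
  have hlog : ∀ v, logForm f lam x v = ∑ i, a i / mapΛ f Λ x i * fderiv ℂ (mapΛ f Λ) x v i := by
    intro v
    rw [hlam x hx]
    simp only [sum_apply, smul_apply, smul_eq_mul]
    refine Finset.sum_congr rfl fun i _ => ?_
    rw [fderiv_mapΛ_apply hx, ← mul_assoc, div_mul_cancel₀ _ (mapΛ_ne_zero hx i)]
  rw [MasterFunction.mem_crit_iff]
  refine ⟨fun ⟨_, h0⟩ => ?_, fun h => ⟨hx, ?_⟩⟩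
  -- `γ` is the affine differential of `P` at the image point and `β` is `∑ a_i d log y_i`. The
  -- image of the differential equals `ker γ` by dimension, and criticality says that `β` vanishes
  -- there, so `β` is a multiple of `γ`.
  · let γ : Module.Dual ℂ (Fin q → ℂ) := ∑ i, grad P y i.succ • LinearMap.proj i
    let β : Module.Dual ℂ (Fin q → ℂ) := ∑ i, (a i / mapΛ f Λ x i) • LinearMap.proj i
    have hγ1 : ∀ i, γ (Pi.single i 1) = grad P y i.succ := fun i => by
      simp [γ, LinearMap.sum_apply, Pi.single_apply]
    have hβ1 : ∀ i, β (Pi.single i 1) = a i / mapΛ f Λ x i := fun i => by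
      simp [β, LinearMap.sum_apply, Pi.single_apply]
    have hγ : γ ≠ 0 := by
      intro hγ0
      refine hρ (funext fun k => ?_)
      have hs : ∀ i : Fin q, rhoVec P y i.succ = 0 := fun i => by
        rw [hρs, ← hγ1, hγ0]; simp
      refine Fin.cases ?_ (fun i => hs i) k
      simpa [hs] using hsum
    have hle : LinearMap.range (fderiv ℂ (mapΛ f Λ) x).toLinearMap ≤ LinearMap.ker γ := by
      rintro _ ⟨v, rfl⟩
      simpa [γ, LinearMap.sum_apply] using hP.sum_grad_mul_fderiv hx v
    have hfin := Module.Dual.finrank_ker_add_one_of_ne_zero hγ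
    have heq := Submodule.eq_of_le_of_finrank_eq hle (by
      rw [hnonsing x hx]; simp at hfin; omega)
    have hker : LinearMap.ker γ ≤ LinearMap.ker β := by
      rw [← heq]
      rintro _ ⟨v, rfl⟩
      have := hlog v
      rw [h0] at this
      simpa [β, LinearMap.sum_apply] using this.symm
    have hmem := mem_span_of_iInf_ker_le_ker (L := fun _ : Unit => γ) (K := β) (by simpa using hker)
    rw [Set.range_const, Submodule.mem_span_singleton] at hmem
    obtain ⟨c, hc⟩ := hmem
    have hac : ∀ i, a i = c * rhoVec P y i.succ := by
      intro i
      have h1 := hβ1 i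
      rw [← hc, LinearMap.smul_apply, hγ1, smul_eq_mul, eq_div_iff (mapΛ_ne_zero hx i)] at h1
      rw [← h1, hρs]; ring
    have hac0 : -∑ i, a i = c * rhoVec P y 0 := by
      rw [eq_neg_of_add_eq_zero_left hsum]
      simp only [hac, ← Finset.mul_sum]
      ring
    intro k
    rw [hac0]
    refine Fin.cases ?_ (fun i => ?_) k
    · simp
    · simp only [Matrix.cons_val_succ, hac]; ring
  · have hρ0 : rhoVec P y 0 ≠ 0 := by
      intro h0
      refine hρ (funext fun k => ?_)
      have := h k
      rw [h0, mul_zero] at this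
      exact (mul_eq_zero.1 this).resolve_left ha0
    ext1 v
    rw [hlog]
    have hi : ∀ i, a i / mapΛ f Λ x i = (-∑ i, a i) / rhoVec P y 0 * grad P y i.succ := by
      intro i
      have := h i.succ
      rw [Matrix.cons_val_succ, hρs] at this
      have hne := mapΛ_ne_zero (Λ := Λ) hx i
      field_simp
      rw [← this]; ring
    simp only [hi, mul_assoc, ← Finset.mul_sum]
    rw [hP.sum_grad_mul_fderiv hx]
    simp

end MasterFunction

noncomputable section

namespace MasterFunction

variable {ℓ n q : ℕ}

/-! ### Clearing denominators -/

/-- Polynomial homogeneous coordinates of `Φ_Λ`. -/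
def polyCoord (f : Fin n → MvPolynomial (Fin ℓ) ℂ) (Λ : Fin q → Fin n → ℤ) :
    Fin (q + 1) → MvPolynomial (Fin ℓ) ℂ :=
  Fin.cons (∏ j, f j ^ ∑ i, ∑ j, (Λ i j).natAbs)
    fun i => ∏ j, f j ^ (((∑ i, ∑ j, (Λ i j).natAbs : ℕ) : ℤ) + Λ i j).toNat

variable {f : Fin n → MvPolynomial (Fin ℓ) ℂ} {Λ : Fin q → Fin n → ℤ}
  {P : MvPolynomial (Fin (q + 1)) ℂ}

theorem eval_polyCoord_zero_ne {x : Fin ℓ → ℂ} (hx : x ∈ compl f) :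
    eval x (polyCoord f Λ 0) ≠ 0 := by
  simp only [polyCoord, Fin.cons_zero, map_prod, map_pow]
  exact Finset.prod_ne_zero_iff.2 fun j _ => pow_ne_zero _ (hx j)

theorem eval_polyCoord {x : Fin ℓ → ℂ} (hx : x ∈ compl f) (k : Fin (q + 1)) :
    eval x (polyCoord f Λ k) = eval x (polyCoord f Λ 0) * homCoord f Λ x k := by
  refine Fin.cases (by simp [homCoord]) (fun i => ?_) k
  simp only [polyCoord, homCoord, Fin.cons_zero, Fin.cons_succ, Matrix.cons_val_succ, mapΛ,
    map_prod, map_pow, ← Finset.prod_mul_distrib]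
  refine Finset.prod_congr rfl fun j _ => ?_
  -- The common exponent dominates every `|Λ i j|`, so `toNat` truncates nothing.
  have hle : (Λ i j).natAbs ≤ ∑ i, ∑ j, (Λ i j).natAbs :=
    (Finset.single_le_sum (f := fun j => (Λ i j).natAbs) (fun _ _ => Nat.zero_le _)
      (Finset.mem_univ j)).trans
      (Finset.single_le_sum (f := fun i => ∑ j, (Λ i j).natAbs) (fun _ _ => Nat.zero_le _)
        (Finset.mem_univ i))
  rw [← zpow_natCast, ← zpow_natCast, ← zpow_add₀ (hx j), Int.toNat_of_nonneg (by omega)]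

theorem eval_bind₁_polyCoord {F : MvPolynomial (Fin (q + 1)) ℂ} {d : ℕ} (hF : F.IsHomogeneous d)
    {x : Fin ℓ → ℂ} (hx : x ∈ compl f) :
    eval x (bind₁ (polyCoord f Λ) F) =
      eval x (polyCoord f Λ 0) ^ d * eval (homCoord f Λ x) F := by
  have h : (fun k => eval x (polyCoord f Λ k)) = eval x (polyCoord f Λ 0) • homCoord f Λ x := by
    ext k
    rw [eval_polyCoord hx, Pi.smul_apply, smul_eq_mul]
  rw [← hF.eval_smul (eval x (polyCoord f Λ 0)) (homCoord f Λ x), ← h]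
  exact eval₂Hom_bind₁ (RingHom.id ℂ) x (polyCoord f Λ) F

/-! ### The codimension of fibres -/

/-- The derivation of the polynomial ring along a constant vector field. -/
def dirDerivation (v : Fin ℓ → ℂ) :
    Derivation ℂ (MvPolynomial (Fin ℓ) ℂ) (MvPolynomial (Fin ℓ) ℂ) :=
  ∑ i, (C (v i) : MvPolynomial (Fin ℓ) ℂ) • pderiv i

theorem eval_dirDerivation (v x : Fin ℓ → ℂ) (p : MvPolynomial (Fin ℓ) ℂ) :
    eval x (dirDerivation v p) = fderiv ℂ (fun y : Fin ℓ → ℂ => eval y p) x v := by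
  rw [fderiv_eval_apply, dirDerivation, Derivation.sum_apply, map_sum]
  simp [mul_comm]

/-- An irreducible set on which `Φ_Λ` is constant has codimension at least the rank of `Φ_Λ`. -/
theorem le_codim_of_mapΛ_eq {r : ℕ} (hnonsing : IsNonsingularMap f Λ r) {Z : Set (Fin ℓ → ℂ)}
    (hZ : @IsIrreducible _ (zariskiAffine ℓ) Z) (hZU : Z ⊆ compl f) {y : Fin q → ℂ}
    (hy : ∀ x ∈ Z, mapΛ f Λ x = y) : (r : ℕ∞) ≤ codim Z := by
  obtain ⟨x, hxZ⟩ := hZ.1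
  have hx := hZU hxZ
  have := isPrime_vanishingIdeal hZ
  set L := fderiv ℂ (mapΛ f Λ) x
  -- `π` extends the coordinates on the image of `L`, and the `v j` lift its basis. Composing the
  -- equations of the fibre with `π` and differentiating along the `v j` turns the Jacobian at `x`
  -- into a nonzero scalar matrix.
  let b := Module.finBasisOfFinrankEq ℂ (LinearMap.range L.toLinearMap) (hnonsing x hx)
  obtain ⟨π, hπ⟩ := LinearMap.exists_extend b.equivFun.toLinearMap
  have hv : ∀ j, ∃ v, L v = b j := fun j => (b j).2
  choose v hv using hv
  have hπb : ∀ j, π (b j) = Pi.single j 1 := by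
    intro j
    have := LinearMap.congr_fun hπ (b j)
    simp only [LinearMap.comp_apply, Submodule.subtype_apply] at this
    rw [this]
    ext k
    simp [Pi.single_apply, eq_comm]
  let g : Fin q → MvPolynomial (Fin ℓ) ℂ := fun i =>
    polyCoord f Λ i.succ - C (y i) * polyCoord f Λ 0
  have hg : ∀ i, ∀ w ∈ compl f,
      eval w (g i) = eval w (polyCoord f Λ 0) * (mapΛ f Λ w i - y i) := by
    intro i w hw
    simp only [g, map_sub, map_mul, eval_C]
    rw [eval_polyCoord hw]
    simp only [homCoord, Matrix.cons_val_succ]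
    ring
  have hdg : ∀ i w, fderiv ℂ (fun u => eval u (g i)) x w = eval x (polyCoord f Λ 0) * L w i := by
    intro i w
    have h1 := (hasFDerivAt_eval (polyCoord f Λ 0) x).fun_mul
      ((hasFDerivAt_pi'.1 (differentiableAt_mapΛ (Λ := Λ) hx).hasFDerivAt i).sub_const (y i))
    have h2 : (fun u => eval u (g i)) =ᶠ[𝓝 x]
        fun u => eval u (polyCoord f Λ 0) * (mapΛ f Λ u i - y i) := by
      filter_upwards [(isOpen_compl f).mem_nhds hx] with u hu using hg i u hu
    -- The derivative of the cleared denominator drops out because `mapΛ f Λ x = y`.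
    rw [h2.fderiv_eq, h1.fderiv, hy x hxZ]
    simp [L]
  refine Ideal.le_height_of_det_derivation (K := ℂ) r _
    (fun k => ∑ i, C (π (Pi.single i 1) k) * g i) (fun j => dirDerivation (v j)) (fun k => ?_) ?_
  · refine Ideal.sum_mem _ fun i _ => Ideal.mul_mem_left _ _ fun w hw => ?_
    rw [aeval_eq_eval, hg i w (hZU hw), hy w hw, sub_self, mul_zero]
  · intro hmem
    have h0 := hmem x hxZ
    rw [aeval_eq_eval, RingHom.map_det] at h0
    have hmat : (eval x).mapMatrix (Matrix.of fun k j =>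
        dirDerivation (v j) (∑ i, C (π (Pi.single i 1) k) * g i)) =
        eval x (polyCoord f Λ 0) • (1 : Matrix (Fin r) (Fin r) ℂ) := by
      ext k j
      have hsum : π (b j) k = ∑ i, L (v j) i * π (Pi.single i 1) k := by
        rw [← hv j]
        conv_lhs => rw [← Finset.univ_sum_single (L (v j)), map_sum, Finset.sum_apply]
        refine Finset.sum_congr rfl fun i _ => ?_
        rw [← smul_eq_mul, ← Pi.smul_apply, ← map_smul, ← Pi.single_smul, smul_eq_mul, mul_one]
      have h1 : ∀ i, eval x (dirDerivation (v j) (C (π (Pi.single i 1) k) * g i)) =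
          eval x (polyCoord f Λ 0) * (L (v j) i * π (Pi.single i 1) k) := by
        intro i
        rw [C_mul', Derivation.map_smul, smul_eval, eval_dirDerivation, hdg]
        ring
      simp only [RingHom.mapMatrix_apply, Matrix.map_apply, Matrix.of_apply, map_sum, h1,
        ← Finset.mul_sum, ← hsum, hπb, Matrix.smul_apply, smul_eq_mul, Matrix.one_apply,
        Pi.single_apply]
    rw [hmat, Matrix.det_smul, Matrix.det_one, mul_one] at h0
    exact pow_ne_zero _ (eval_polyCoord_zero_ne hx) h0

/-- If `Φ_Λ` takes only finitely many values on an irreducible set, then it is constant there. -/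
theorem exists_mapΛ_eq_of_finite {Z : Set (Fin ℓ → ℂ)}
    (hZ : @IsIrreducible _ (zariskiAffine ℓ) Z) (hZU : Z ⊆ compl f)
    (hfin : (mapΛ f Λ '' Z).Finite) : ∃ y : Fin q → ℂ, ∀ x ∈ Z, mapΛ f Λ x = y := by
  have := isPrime_vanishingIdeal hZ
  have hg : ∀ (i : Fin q) (c : ℂ), ∀ x ∈ Z,
      (eval x (polyCoord f Λ i.succ - C c * polyCoord f Λ 0) = 0 ↔ mapΛ f Λ x i = c) := by
    intro i c x hx
    have h0 := eval_polyCoord_zero_ne (Λ := Λ) (hZU hx)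
    rw [map_sub, map_mul, eval_C, eval_polyCoord (hZU hx), mul_comm c, ← mul_sub, mul_eq_zero,
      or_iff_right h0, sub_eq_zero]
    rfl
  have hi : ∀ i : Fin q, ∃ c : ℂ, ∀ x ∈ Z, mapΛ f Λ x i = c := by
    intro i
    -- The product over all values vanishes on `Z`; primality selects one factor, that is, one value
    -- of the coordinate.
    have hmem : ∏ w ∈ hfin.toFinset, (polyCoord f Λ i.succ - C (w i) * polyCoord f Λ 0) ∈
        vanishingIdeal ℂ Z := by
      intro x hx
      rw [aeval_eq_eval, map_prod]
      exact Finset.prod_eq_zero (hfin.mem_toFinset.2 ⟨x, hx, rfl⟩) ((hg i _ x hx).2 rfl)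
    obtain ⟨w, -, hw⟩ := (Ideal.IsPrime.prod_mem_iff).1 hmem
    exact ⟨w i, fun x hx => (hg i _ x hx).1 (by simpa [aeval_eq_eval] using hw x hx)⟩
  choose y hy using hi
  exact ⟨y, fun x hx => funext fun i => hy i x hx⟩

/-! ### The fibres of `ρ` -/

/-- The polynomial `a_0 z_k ∂_k P - a_k z_0 ∂_0 P`. -/
def rhoEq (P : MvPolynomial (Fin (q + 1)) ℂ) (a : Fin (q + 1) → ℂ) (k : Fin (q + 1)) :
    MvPolynomial (Fin (q + 1)) ℂ :=
  C (a 0) * (X k * pderiv k P) - C (a k) * (X 0 * pderiv 0 P)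

theorem eval_rhoEq (a : Fin (q + 1) → ℂ) (k : Fin (q + 1)) (z : Fin (q + 1) → ℂ) :
    eval z (rhoEq P a k) = a 0 * rhoVec P z k - a k * rhoVec P z 0 := by
  simp [rhoEq, rhoVec, grad]

theorem isHomogeneous_rhoEq {d : ℕ} (hd : P.IsHomogeneous d) (a : Fin (q + 1) → ℂ)
    (k : Fin (q + 1)) : (rhoEq P a k).IsHomogeneous (1 + (d - 1)) :=
  (((isHomogeneous_X ℂ k).mul hd.pderiv).C_mul _).sub
    (((isHomogeneous_X ℂ 0).mul hd.pderiv).C_mul _)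

/-- The fibres of `ρ` are finite off `z_0 = 0`. -/
theorem IsHypersurfaceOf.finite_rho_fibre (hP : IsHypersurfaceOf f Λ P)
    (htrans : MeetsCoordTransversely P (closureY f Λ)) {a : Fin (q + 1) → ℂ} (ha : a 0 ≠ 0) :
    {z : Fin (q + 1) → ℂ | eval z P = 0 ∧ (∀ k, a 0 * rhoVec P z k = a k * rhoVec P z 0) ∧
      z 0 = 1}.Finite := by
  obtain ⟨d, hd⟩ := hP.2.1
  let S : Set (MvPolynomial (Fin (q + 1)) ℂ) := insert P (Set.range (rhoEq P a))
  have hmem : ∀ z, z ∈ zeroLocus ℂ (Ideal.span S) ↔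
      eval z P = 0 ∧ ∀ k, a 0 * rhoVec P z k = a k * rhoVec P z 0 := by
    intro z
    simp [zeroLocus_span, S, aeval_eq_eval, eval_rhoEq, sub_eq_zero]
  have hS : ∀ F ∈ S, ∃ e, F.IsHomogeneous e := by
    rintro F (rfl | ⟨k, rfl⟩)
    · exact ⟨d, hd⟩
    · exact ⟨_, isHomogeneous_rhoEq hd a k⟩
  refine (finite_zeroLocus_inter_chart (Ideal.span S) (homogeneousComponent_mem_span hS)
    fun z hz hz0 => ?_).subset fun z hz => ⟨(hmem z).2 ⟨hz.1, hz.2.1⟩, hz.2.2⟩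
  -- On `z_0 = 0` the zeroth coordinate of `ρ` vanishes, and `a 0 ≠ 0` then forces all the others to
  -- vanish too.
  by_contra hne
  obtain ⟨hzP, hzρ⟩ := (hmem z).1 hz
  refine hP.rhoVec_ne_zero htrans hne hzP (funext fun k => ?_)
  have h0 : rhoVec P z 0 = 0 := by simp [rhoVec, hz0]
  have := hzρ k
  rw [h0, mul_zero] at this
  exact (mul_eq_zero.1 this).resolve_left ha

theorem compl_nonempty (hf : IsArrangement f) : (compl f).Nonempty := by
  by_contra hne
  have h : ∏ j, f j = 0 := by
    refine MvPolynomial.funext fun x => ?_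
    rw [map_zero, map_prod]
    by_contra h0
    exact hne ⟨x, fun j => Finset.prod_ne_zero_iff.1 h0 j (Finset.mem_univ j)⟩
  obtain ⟨j, -, hj⟩ := Finset.prod_eq_zero_iff.1 h
  have := hf.degree_one j
  simp [hj] at this

theorem IsHypersurfaceOf.pos_degree (hP : IsHypersurfaceOf f Λ P) (hf : IsArrangement f) {d : ℕ}
    (hd : P.IsHomogeneous d) : d ≠ 0 := by
  rintro rfl
  obtain ⟨x, hx⟩ := compl_nonempty hf
  have h := hP.eval_homCoord hx
  rw [totalDegree_eq_zero_iff_eq_C.1 ((totalDegree_zero_iff_isHomogeneous _).2 hd), eval_C] at h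
  refine hP.1 ?_
  rw [totalDegree_eq_zero_iff_eq_C.1 ((totalDegree_zero_iff_isHomogeneous _).2 hd), h, C_0]

/-- For vectors with coordinate sum zero, all but the last of the equations that express
proportionality suffice. -/
theorem proportional_of_sum_eq_zero {r : ℕ} {a w : Fin (r + 2) → ℂ} (ha : ∑ k, a k = 0)
    (hw : ∑ k, w k = 0) (h : ∀ k : Fin r, a 0 * w k.castSucc.succ = a k.castSucc.succ * w 0)
    (k : Fin (r + 2)) : a 0 * w k = a k * w 0 := by
  refine Fin.cases rfl (fun i => ?_) k
  refine Fin.lastCases ?_ h i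
  have h1 : ∑ k, (a 0 * w k - a k * w 0) = 0 := by
    rw [Finset.sum_sub_distrib, ← Finset.mul_sum, ← Finset.sum_mul, ha, hw]
    simp
  rw [Fin.sum_univ_succ, Fin.sum_univ_castSucc] at h1
  simpa [h, sub_eq_zero] using h1

/-- `ρ` maps the hypersurface onto the hyperplane of vectors with coordinate sum zero. -/
theorem exists_rhoVec_proportional {r : ℕ} {Λ : Fin (r + 1) → Fin n → ℤ}
    {P : MvPolynomial (Fin (r + 2)) ℂ} (hP : IsHypersurfaceOf f Λ P) (hf : IsArrangement f)
    {a : Fin (r + 2) → ℂ} (ha : ∑ k, a k = 0) :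
    ∃ z : Fin (r + 2) → ℂ, z ≠ 0 ∧ eval z P = 0 ∧
      ∀ k, a 0 * rhoVec P z k = a k * rhoVec P z 0 := by
  obtain ⟨d, hd⟩ := hP.2.1
  have hd0 := hP.pos_degree hf hd
  -- `P` and `r` of the proportionality equations: `r + 1` equations in `r + 2` unknowns.
  obtain ⟨z, hz, hzF⟩ := exists_ne_zero_forall_eval_eq_zero (K := ℂ) (Nat.lt_succ_self (r + 1))
    (Fin.cons P fun k : Fin r => rhoEq P a k.castSucc.succ) (by
      refine Fin.cases ?_ fun k => ?_
      · have := hd.eval_smul 0 0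
        rwa [smul_zero, zero_pow hd0, zero_mul] at this
      · rw [Fin.cons_succ, eval_rhoEq]; simp [rhoVec])
  have hzP : eval z P = 0 := hzF 0
  refine ⟨z, hz, hzP, proportional_of_sum_eq_zero ha (by rw [sum_rhoVec hd, hzP, mul_zero])
    fun k => ?_⟩
  have := hzF k.succ
  rwa [Fin.cons_succ, eval_rhoEq, sub_eq_zero] at this

end MasterFunction

end

theorem mainTheorem8 {ℓ n q : ℕ}
    (f : Fin n → MvPolynomial (Fin ℓ) ℂ) (hf : MasterFunction.IsArrangement f)
    (Λ : Fin q → Fin n → ℤ)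
    (hΛ : LinearIndependent ℂ
      (fun (i : Fin q) (x : MasterFunction.compl f) =>
        MasterFunction.logForm f (fun j => (Λ i j : ℂ)) x))
    (P : MvPolynomial (Fin (q + 1)) ℂ)
    (hP : MasterFunction.IsHypersurfaceOf f Λ P)
    (hnonsing : MasterFunction.IsNonsingularMap f Λ (q - 1))
    (hsmooth : MasterFunction.IsNonsingularHypersurface P (MasterFunction.closureY f Λ))
    (htrans : MasterFunction.MeetsCoordTransversely P (MasterFunction.closureY f Λ))
    (hdim : MasterFunction.projDim
        (MasterFunction.rhoImage P (MasterFunction.closureY f Λ)) =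
      MasterFunction.projDim (MasterFunction.closureY f Λ))
    (himage : MasterFunction.imageY f Λ =
      MasterFunction.closureY f Λ ∩ MasterFunction.torus q)
    (a : Fin q → ℂ) (ha : ∀ i, a i ≠ 0) (ha0 : -∑ i, a i ≠ 0)
    (lam : Fin n → ℂ)
    (hlam : ∀ x ∈ MasterFunction.compl f,
      MasterFunction.logForm f lam x =
        ∑ i, a i • MasterFunction.logForm f (fun j => (Λ i j : ℂ)) x) :
    (MasterFunction.crit f lam).Nonempty ∧
      ∀ Z : Set (Fin ℓ → ℂ), MasterFunction.IsComponent (MasterFunction.crit f lam) Z →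
        MasterFunction.codim Z = ((q - 1 : ℕ) : ℕ∞) := by
  open MasterFunction in
  -- For `q = 0` the empty sum would make `a_0` zero.
  obtain _ | r := q
  · simp at ha0
  have hcrit := fun {x} (hx : x ∈ compl f) => hP.mem_crit_iff htrans hnonsing ha0 hlam hx
  obtain ⟨d, hd⟩ := hP.2.1
  set b : Fin (r + 2) → ℂ := Matrix.vecCons (-∑ i, a i) a with hb
  have hb0 : b 0 = -∑ i, a i := rfl
  have hbne : ∀ k, b k ≠ 0 := Fin.cases ha0 ha
  have hbsum : ∑ k, b k = 0 := by
    rw [Fin.sum_univ_succ]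
    simp [b]
  rw [← hb0] at ha0
  simp only [← hb0] at hcrit
  refine ⟨?_, fun Z hZ => le_antisymm ?_ ?_⟩
  · obtain ⟨z, hz, hzP, hzρ⟩ := exists_rhoVec_proportional hP hf hbsum
    have hρ := hP.rhoVec_ne_zero htrans hz hzP
    have hρ0 : rhoVec P z 0 ≠ 0 := fun h0 => hρ <| funext fun k => by
      have := hzρ k
      rw [h0, mul_zero] at this
      exact (mul_eq_zero.1 this).resolve_left ha0
    have hz0 : ∀ k, z k ≠ 0 := by
      intro k hk
      have := hzρ k
      rw [rhoVec, hk, zero_mul, mul_zero] at this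
      exact mul_ne_zero (hbne k) hρ0 this.symm
    have hmem : Projectivization.mk ℂ z hz ∈ imageY f Λ := by
      rw [himage]
      refine ⟨hP.mk_mem_closureY hz hzP, fun k => ?_⟩
      obtain ⟨c, hc, hrep⟩ := exists_rep_eq hz
      rw [hrep]
      exact mul_ne_zero hc (hz0 k)
    obtain ⟨x, hx, hxz⟩ := hmem
    obtain ⟨c, hc⟩ := (Projectivization.mk_eq_mk_iff' ℂ _ _ _ _).1 hxz
    refine ⟨x, (hcrit hx).2 fun k => ?_⟩
    rw [← hc, rhoVec_smul hd]
    simp only [Pi.smul_apply, smul_eq_mul, mul_left_comm _ (c ^ _), hzρ k]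
  -- `P` already vanishes on the image, so only the `r` proportionality equations need to be pulled
  -- back.
  · refine codim_le_of_isComponent (h := ∏ j, f j)
      (G := fun k : Fin r => bind₁ (polyCoord f Λ) (rhoEq P b k.castSucc.succ)) (fun x => ?_) hZ
    have hU : eval x (∏ j, f j) ≠ 0 ↔ x ∈ compl f := by
      simp [Finset.prod_ne_zero_iff, MasterFunction.compl]
    rw [hU]
    refine ⟨fun hx => ⟨hx.1, fun k => ?_⟩, fun ⟨hx, hG⟩ => (hcrit hx).2 ?_⟩
    · rw [eval_bind₁_polyCoord (isHomogeneous_rhoEq hd b _) hx.1, eval_rhoEq,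
        (hcrit hx.1).1 hx, sub_self, mul_zero]
    · refine proportional_of_sum_eq_zero hbsum
        (by rw [sum_rhoVec hd, hP.eval_homCoord hx, mul_zero]) fun k => ?_
      have := hG k
      rw [eval_bind₁_polyCoord (isHomogeneous_rhoEq hd b _) hx, eval_rhoEq] at this
      exact sub_eq_zero.1
        ((mul_eq_zero.1 this).resolve_left (pow_ne_zero _ (eval_polyCoord_zero_ne hx)))
  · have hZirr := hZ.1.2
    have hZU : Z ⊆ compl f := fun x hx => (hZ.1.1 hx).1
    have hfin : (mapΛ f Λ '' Z).Finite := by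
      refine ((hP.finite_rho_fibre htrans ha0).image fun z i => z (Fin.succ i)).subset ?_
      rintro _ ⟨x, hx, rfl⟩
      exact ⟨homCoord f Λ x, ⟨hP.eval_homCoord (hZU hx), (hcrit (hZU hx)).1 (hZ.1.1 hx), rfl⟩,
        rfl⟩
    obtain ⟨y, hy⟩ := exists_mapΛ_eq_of_finite hZirr hZU hfin
    exact le_codim_of_mapΛ_eq hnonsing hZirr hZU hy
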